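/- Let $H$ and $K$ be complex Hilbert spaces, let $A$ be a bounded self-adjoint operator on $H$ and let $B$ be a bounded self-adjoint operator on $K$, with spectra $\Sigma(A), \Sigma(B) \subset \mathbf R$. Let $H \otimes K$ denote the Hilbert space tensor product, that is, the completion of the algebraic tensor product with respect to the inner product determined by $\langle x \otimes y, x' \otimes y' \rangle = \langle x, x' \rangle \langle y, y' \rangle$, and, for bounded operators $S$ on $H$ and $T$ on $K$, let $S \otimes T$ denote the bounded operator on $H \otimes K$ determined by $(S \otimes T)(x \otimes y) = Sx \otimes Ty$. Then: (i) the spectrum of $A \otimes \mathrm{id}_K + \mathrm{id}_H \otimes B$ is $\{ z \in \mathbf R \mid z = x + y \text{ for some } x \in \Sigma(A) \text{ and } y \in \Sigma(B) \}$; (ii) the spectrum of $A \otimes B$ is $\{ z \in \mathbf R \mid z = xy \text{ for some } x \in \Sigma(A) \text{ and } y \in \Sigma(B) \}$; (iii) the spectrum of $A \otimes \mathrm{id}_K + \mathrm{id}_H \otimes B + A \otimes B$ is $\{ z \in \mathbf R \mid z = x + y + xy \text{ for some } x \in \Sigma(A) \text{ and } y \in \Sigma(B) \}$. -/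

import Mathlib

open scoped TensorProduct

noncomputable section

/-- The Hilbert tensor product of two complex Hilbert spaces: the completion of the algebraic
tensor product for the inner product `⟪x ⊗ y, x' ⊗ y'⟫ = ⟪x, x'⟫ * ⟪y, y'⟫`. -/
abbrev HilbertTensor (H K : Type*) [NormedAddCommGroup H] [InnerProductSpace ℂ H]
    [NormedAddCommGroup K] [InnerProductSpace ℂ K] : Type _ :=
  UniformSpace.Completion (H ⊗[ℂ] K)

/-- The bounded operator `A ⊗ B` on the Hilbert tensor product: the continuous extension of
the map `x ⊗ y ↦ A x ⊗ B y` from the algebraic tensor product to its completion. -/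
def tensorOp {H K : Type*} [NormedAddCommGroup H] [InnerProductSpace ℂ H]
    [NormedAddCommGroup K] [InnerProductSpace ℂ K] (A : H →L[ℂ] H) (B : K →L[ℂ] K) :
    HilbertTensor H K →L[ℂ] HilbertTensor H K :=
  (TensorProduct.mapL A B).completion

theorem tensorOp_coe_tmul {H K : Type*} [NormedAddCommGroup H] [InnerProductSpace ℂ H]
    [NormedAddCommGroup K] [InnerProductSpace ℂ K] (A : H →L[ℂ] H) (B : K →L[ℂ] K)
    (x : H) (y : K) :
    tensorOp A B ((x ⊗ₜ[ℂ] y : H ⊗[ℂ] K) : HilbertTensor H K) =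
      ((A x ⊗ₜ[ℂ] B y : H ⊗[ℂ] K) : HilbertTensor H K) := by
  simp [tensorOp]

end

/-! All three operators have the form `p(A ⊗ 1, 1 ⊗ B)` with `p(s, t) = αs + βt + γst`, so one
computation serves for all. Upper bound: commuting elements lie in a commutative Banach algebra,
where each spectral value of `p(a, b)` is `φ(p(a, b)) = p(φ a, φ b)` for a character `φ`. Ampliation
is a unital homomorphism, hence does not enlarge spectra. Lower bound: by self-adjointness, spectral
values are approximate eigenvalues; if `u`, `v` are approximate eigenvectors for `x`, `y`, then `u ⊗
v` is one for `p(x, y)`. -/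

section BanachAlgebra

variable {R : Type*} [NormedRing R] [NormedAlgebra ℂ R]

/-- A centralizer is inverse-closed, so passing to it does not enlarge spectra. -/
theorem spectrum_subset_of_centralizer {s : Set R} (a : Subalgebra.centralizer ℂ s) :
    spectrum ℂ a ⊆ spectrum ℂ (a : R) := by
  intro z hz hunit
  refine hz ?_
  obtain ⟨u, hu⟩ := hunit
  have hmem : (u : R) ∈ Subalgebra.centralizer ℂ s := by
    rw [hu]
    exact (algebraMap ℂ (Subalgebra.centralizer ℂ s) z - a).2
  have hinv : ((u⁻¹ : Rˣ) : R) ∈ Subalgebra.centralizer ℂ s := by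
    rw [Subalgebra.mem_centralizer_iff] at hmem ⊢
    exact fun g hg => (show Commute g (u : R) from hmem g hg).units_inv_right
  have h : algebraMap ℂ (Subalgebra.centralizer ℂ s) z - a = ⟨u, hmem⟩ := Subtype.ext hu.symm
  rw [spectrum.mem_resolventSet_iff, h]
  exact ⟨⟨⟨u, hmem⟩, ⟨_, hinv⟩, Subtype.ext u.mul_inv, Subtype.ext u.inv_mul⟩, rfl⟩

/-- Spectral mapping inclusion for a bilinear polynomial in two commuting elements. -/
theorem Commute.exists_mem_spectrum_of_mem_spectrum_bilinear [CompleteSpace R] {a b : R}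
    (hab : Commute a b) (α β γ : ℂ) {z : ℂ}
    (hz : z ∈ spectrum ℂ (α • a + β • b + γ • (a * b))) :
    ∃ x ∈ spectrum ℂ a, ∃ y ∈ spectrum ℂ b, z = α * x + β * y + γ * (x * y) := by
  -- The bicommutant of `{a, b}` is commutative, closed and inverse-closed, so Gelfand theory
  -- applies and spectra are the same as in `R`.
  let s : Set R := ({a, b} : Set R).centralizer
  let S := Subalgebra.centralizer ℂ s
  have hsub : ({a, b} : Set R) ⊆ S := Set.subset_centralizer_centralizer
  have hcomm : ∀ c ∈ S, ∀ d ∈ S, c * d = d * c := by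
    refine Set.centralizer_centralizer_comm_of_comm ?_
    rintro c (rfl | rfl) d (rfl | rfl)
    exacts [rfl, hab, hab.symm, rfl]
  have hclosed : IsClosed (S : Set R) := Set.isClosed_centralizer s
  have : CompleteSpace S := hclosed.completeSpace_coe
  let _ : NormedCommRing S :=
    { (inferInstance : NormedRing S) with
      mul_comm := fun c d => Subtype.ext (hcomm c c.2 d d.2) }
  let a' : S := ⟨a, hsub (by simp)⟩
  let b' : S := ⟨b, hsub (by simp)⟩
  have hz' : z ∈ spectrum ℂ (α • a' + β • b' + γ • (a' * b')) :=
    AlgHom.spectrum_apply_subset S.val _ hz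
  obtain ⟨φ, hφ⟩ := WeakDual.CharacterSpace.mem_spectrum_iff_exists.1 hz'
  refine ⟨φ a', spectrum_subset_of_centralizer a' (AlgHom.apply_mem_spectrum φ a'),
    φ b', spectrum_subset_of_centralizer b' (AlgHom.apply_mem_spectrum φ b'), ?_⟩
  rw [← hφ]
  simp only [map_add, map_smul, map_mul, smul_eq_mul]

theorem ContinuousLinearMap.exists_mem_spectrum_of_mem_spectrum_bilinear {E : Type*}
    [NormedAddCommGroup E] [NormedSpace ℂ E] [CompleteSpace E] {S T : E →L[ℂ] E}
    (hST : Commute S T) (α β γ : ℂ) {z : ℂ}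
    (hz : z ∈ spectrum ℂ (α • S + β • T + γ • (S * T))) :
    ∃ x ∈ spectrum ℂ S, ∃ y ∈ spectrum ℂ T, z = α * x + β * y + γ * (x * y) :=
  hST.exists_mem_spectrum_of_mem_spectrum_bilinear α β γ hz

end BanachAlgebra

section ApproximateEigenvectors

variable {H : Type*} [NormedAddCommGroup H] [InnerProductSpace ℂ H] [CompleteSpace H]

/-- Since `⟪T²u, u⟫ = ‖Tu‖² ≥ c²‖u‖²`, the operator `T²` is coercive, hence invertible, and then so
is its factor `T`. -/
theorem IsSelfAdjoint.isUnit_of_le_norm_apply {T : H →L[ℂ] H} (hT : IsSelfAdjoint T) {c : ℝ}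
    (hc : 0 < c) (h : ∀ u, c * ‖u‖ ≤ ‖T u‖) : IsUnit T := by
  have hTT : IsUnit (T * T) := by
    refine ContinuousLinearMap.isUnit_of_forall_le_norm_inner_map _
      (c := ⟨c ^ 2, by positivity⟩) (by exact_mod_cast pow_pos hc 2) fun u => ?_
    have hinner : inner ℂ ((T * T) u) u = inner ℂ (T u) (T u) := hT.isSymmetric (T u) u
    rw [hinner, inner_self_eq_norm_sq_to_K]
    simp only [norm_pow, Complex.coe_algebraMap, Complex.norm_real, norm_norm]
    calc ‖u‖ ^ 2 * c ^ 2 = (c * ‖u‖) ^ 2 := by ring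
      _ ≤ ‖T u‖ ^ 2 := pow_le_pow_left₀ (by positivity) (h u) 2
  exact ((Commute.refl T).isUnit_mul_iff.1 hTT).1

/-- Every spectral value of a self-adjoint operator is an approximate eigenvalue. -/
theorem IsSelfAdjoint.exists_norm_apply_sub_smul_lt {T : H →L[ℂ] H} (hT : IsSelfAdjoint T)
    {x : ℝ} (hx : (x : ℂ) ∈ spectrum ℂ T) {ε : ℝ} (hε : 0 < ε) :
    ∃ u : H, ‖u‖ = 1 ∧ ‖T u - (x : ℂ) • u‖ < ε := by
  by_contra! hcon
  refine hx ?_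
  have hsa : IsSelfAdjoint (algebraMap ℂ (H →L[ℂ] H) x - T) :=
    (IsSelfAdjoint.algebraMap _ (Complex.conj_ofReal x)).sub hT
  refine hsa.isUnit_of_le_norm_apply hε fun u => ?_
  rcases eq_or_ne u 0 with rfl | hu
  · simp
  have hpos : 0 < ‖u‖ := norm_pos_iff.2 hu
  have h := hcon (((‖u‖⁻¹ : ℝ) : ℂ) • u) (by simp [norm_smul, hpos.ne'])
  rw [map_smul, smul_comm, ← smul_sub, norm_smul, Complex.norm_real, norm_inv, norm_norm,
    inv_mul_eq_div, le_div_iff₀ hpos, norm_sub_rev] at h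
  simpa [Algebra.algebraMap_eq_smul_one] using h

end ApproximateEigenvectors

section TensorOp

variable {H K : Type*} [NormedAddCommGroup H] [InnerProductSpace ℂ H]
  [NormedAddCommGroup K] [InnerProductSpace ℂ K]

theorem tensorOp_coe (A : H →L[ℂ] H) (B : K →L[ℂ] K) (w : H ⊗[ℂ] K) :
    tensorOp A B (w : HilbertTensor H K) =
      ((TensorProduct.mapL A B w : H ⊗[ℂ] K) : HilbertTensor H K) :=
  ContinuousLinearMap.completion_apply_coe _ _

theorem HilbertTensor.clm_ext {S T : HilbertTensor H K →L[ℂ] HilbertTensor H K}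
    (h : ∀ w : H ⊗[ℂ] K, S (w : HilbertTensor H K) = T (w : HilbertTensor H K)) : S = T := by
  ext w
  induction w using UniformSpace.Completion.induction_on with
  | hp => exact isClosed_eq S.continuous T.continuous
  | ih w => exact h w

theorem tensorOp_mul (A A₂ : H →L[ℂ] H) (B B₂ : K →L[ℂ] K) :
    tensorOp (A * A₂) (B * B₂) = tensorOp A B * tensorOp A₂ B₂ := by
  refine HilbertTensor.clm_ext fun w => ?_
  rw [mul_apply_eq_comp, tensorOp_coe, tensorOp_coe, tensorOp_coe,
    TensorProduct.mapL_mul, mul_apply_eq_comp]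

theorem tensorOp_one_one : tensorOp (1 : H →L[ℂ] H) (1 : K →L[ℂ] K) = 1 := by
  refine HilbertTensor.clm_ext fun w => ?_
  rw [tensorOp_coe]
  exact congrArg (fun f : H ⊗[ℂ] K →L[ℂ] H ⊗[ℂ] K => ((f w : H ⊗[ℂ] K) : HilbertTensor H K))
    TensorProduct.mapL_id_id

theorem tensorOp_add_left (A A₂ : H →L[ℂ] H) (B : K →L[ℂ] K) :
    tensorOp (A + A₂) B = tensorOp A B + tensorOp A₂ B := by
  refine HilbertTensor.clm_ext fun w => ?_
  rw [add_apply, tensorOp_coe, tensorOp_coe, tensorOp_coe,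
    TensorProduct.mapL_add_left, add_apply, UniformSpace.Completion.coe_add]

theorem tensorOp_add_right (A : H →L[ℂ] H) (B B₂ : K →L[ℂ] K) :
    tensorOp A (B + B₂) = tensorOp A B + tensorOp A B₂ := by
  refine HilbertTensor.clm_ext fun w => ?_
  rw [add_apply, tensorOp_coe, tensorOp_coe, tensorOp_coe,
    TensorProduct.mapL_add_right, add_apply, UniformSpace.Completion.coe_add]

theorem tensorOp_smul_left (r : ℂ) (A : H →L[ℂ] H) (B : K →L[ℂ] K) :
    tensorOp (r • A) B = r • tensorOp A B := by
  refine HilbertTensor.clm_ext fun w => ?_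
  rw [smul_apply, tensorOp_coe, tensorOp_coe,
    TensorProduct.mapL_smul_left, smul_apply, UniformSpace.Completion.coe_smul]

theorem tensorOp_smul_right (r : ℂ) (A : H →L[ℂ] H) (B : K →L[ℂ] K) :
    tensorOp A (r • B) = r • tensorOp A B := by
  refine HilbertTensor.clm_ext fun w => ?_
  rw [smul_apply, tensorOp_coe, tensorOp_coe,
    TensorProduct.mapL_smul_right, smul_apply,
    UniformSpace.Completion.coe_smul]

/-- The ampliation `A ↦ A ⊗ 1`. -/
noncomputable def tensorOpLeft (H K : Type*) [NormedAddCommGroup H] [InnerProductSpace ℂ H]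
    [NormedAddCommGroup K] [InnerProductSpace ℂ K] :
    (H →L[ℂ] H) →ₐ[ℂ] (HilbertTensor H K →L[ℂ] HilbertTensor H K) :=
  AlgHom.ofLinearMap
    { toFun := fun A => tensorOp A 1
      map_add' := fun A A₂ => tensorOp_add_left A A₂ 1
      map_smul' := fun r A => tensorOp_smul_left r A 1 }
    tensorOp_one_one
    (fun A A₂ => (congrArg (tensorOp (A * A₂)) (one_mul 1).symm).trans (tensorOp_mul A A₂ 1 1))

/-- The ampliation `B ↦ 1 ⊗ B`. -/
noncomputable def tensorOpRight (H K : Type*) [NormedAddCommGroup H] [InnerProductSpace ℂ H]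
    [NormedAddCommGroup K] [InnerProductSpace ℂ K] :
    (K →L[ℂ] K) →ₐ[ℂ] (HilbertTensor H K →L[ℂ] HilbertTensor H K) :=
  AlgHom.ofLinearMap
    { toFun := fun B => tensorOp 1 B
      map_add' := fun B B₂ => tensorOp_add_right 1 B B₂
      map_smul' := fun r B => tensorOp_smul_right r 1 B }
    tensorOp_one_one
    (fun B B₂ => (congrArg (tensorOp · (B * B₂)) (one_mul 1).symm).trans (tensorOp_mul 1 1 B B₂))

theorem spectrum_tensorOp_one_right_subset (A : H →L[ℂ] H) :
    spectrum ℂ (tensorOp A (1 : K →L[ℂ] K)) ⊆ spectrum ℂ A :=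
  AlgHom.spectrum_apply_subset (tensorOpLeft H K) A

theorem spectrum_tensorOp_one_left_subset (B : K →L[ℂ] K) :
    spectrum ℂ (tensorOp (1 : H →L[ℂ] H) B) ⊆ spectrum ℂ B :=
  AlgHom.spectrum_apply_subset (tensorOpRight H K) B

theorem tensorOp_one_right_mul_one_left (A : H →L[ℂ] H) (B : K →L[ℂ] K) :
    tensorOp A 1 * tensorOp 1 B = tensorOp A B := by
  rw [← tensorOp_mul, mul_one, one_mul]

theorem commute_tensorOp_one_right_one_left (A : H →L[ℂ] H) (B : K →L[ℂ] K) :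
    Commute (tensorOp A (1 : K →L[ℂ] K)) (tensorOp (1 : H →L[ℂ] H) B) := by
  rw [Commute, SemiconjBy, ← tensorOp_mul, ← tensorOp_mul, mul_one, one_mul, mul_one, one_mul]

/-- Elementary tensors of approximate eigenvectors are approximate eigenvectors. -/
theorem norm_tensorOp_bilinear_sub_smul_le (A : H →L[ℂ] H) (B : K →L[ℂ] K) (α β γ x y : ℂ)
    {u : H} {v : K} (hu : ‖u‖ = 1) (hv : ‖v‖ = 1) {ε : ℝ} (hAu : ‖A u - x • u‖ ≤ ε)
    (hBv : ‖B v - y • v‖ ≤ ε) :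
    ‖(α • tensorOp A 1 + β • tensorOp 1 B + γ • tensorOp A B :
          HilbertTensor H K →L[ℂ] HilbertTensor H K)
          ((u ⊗ₜ[ℂ] v : H ⊗[ℂ] K) : HilbertTensor H K) -
        (α * x + β * y + γ * (x * y)) • ((u ⊗ₜ[ℂ] v : H ⊗[ℂ] K) : HilbertTensor H K)‖ ≤
      (‖α‖ + ‖β‖ + ‖γ‖ * (‖B‖ + ‖x‖)) * ε := by
  have hε : 0 ≤ ε := (norm_nonneg _).trans hAu
  have hBle : ‖B v‖ ≤ ‖B‖ := by simpa [hv] using B.le_opNorm v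
  -- The product term splits as `Au ⊗ Bv - xy(u ⊗ v) = (A - x)u ⊗ Bv + x(u ⊗ (B - y)v)`, which is
  -- the source of the factor `‖B‖ + ‖x‖`.
  have key : (α • tensorOp A 1 + β • tensorOp 1 B + γ • tensorOp A B :
          HilbertTensor H K →L[ℂ] HilbertTensor H K)
          ((u ⊗ₜ[ℂ] v : H ⊗[ℂ] K) : HilbertTensor H K) -
        (α * x + β * y + γ * (x * y)) • ((u ⊗ₜ[ℂ] v : H ⊗[ℂ] K) : HilbertTensor H K) =
      ((α • ((A u - x • u) ⊗ₜ[ℂ] v) + β • (u ⊗ₜ[ℂ] (B v - y • v)) +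
        γ • ((A u - x • u) ⊗ₜ[ℂ] B v + x • (u ⊗ₜ[ℂ] (B v - y • v))) : H ⊗[ℂ] K) :
          HilbertTensor H K) := by
    simp only [add_apply, smul_apply, tensorOp_coe_tmul,
      one_apply_eq_self, ← UniformSpace.Completion.coe_smul,
      ← UniformSpace.Completion.coe_add, ← UniformSpace.Completion.coe_sub]
    congr 1
    simp only [TensorProduct.sub_tmul, TensorProduct.tmul_sub, ← TensorProduct.smul_tmul',
      TensorProduct.tmul_smul]
    module
  rw [key, UniformSpace.Completion.norm_coe]
  calc _ ≤ ‖α‖ * (ε * 1) + ‖β‖ * (1 * ε) + ‖γ‖ * (ε * ‖B‖ + ‖x‖ * (1 * ε)) := by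
        refine (norm_add₃_le).trans ?_
        simp only [norm_smul, TensorProduct.norm_tmul, hu, hv]
        gcongr
        refine (norm_add_le _ _).trans ?_
        simp only [norm_smul, TensorProduct.norm_tmul, hu]
        gcongr
    _ = _ := by ring

theorem bilinear_mem_spectrum_tensorOp [CompleteSpace H] [CompleteSpace K] {A : H →L[ℂ] H}
    {B : K →L[ℂ] K} (hA : IsSelfAdjoint A) (hB : IsSelfAdjoint B) (α β γ : ℂ) {x y : ℝ}
    (hx : (x : ℂ) ∈ spectrum ℂ A) (hy : (y : ℂ) ∈ spectrum ℂ B) :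
    α * x + β * y + γ * (x * y) ∈
      spectrum ℂ (α • tensorOp A 1 + β • tensorOp 1 B + γ • tensorOp A B) := by
  rintro ⟨S, hS⟩
  set T := α • tensorOp A 1 + β • tensorOp 1 B + γ • tensorOp A B
  set z : ℂ := α * x + β * y + γ * (x * y)
  set R : HilbertTensor H K →L[ℂ] HilbertTensor H K := S.inv
  set C : ℝ := ‖α‖ + ‖β‖ + ‖γ‖ * (‖B‖ + ‖(x : ℂ)‖)
  have hC : 0 ≤ C := by positivity
  -- With this `ε`, `‖R‖Cε < 1`, whereas the inverse `R` of `z - T` would force `1 = ‖w‖ ≤ ‖R‖Cε`.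
  -- The added `1` covers `‖R‖C = 0`.
  have hε : 0 < (‖R‖ * C + 1)⁻¹ := by positivity
  obtain ⟨u, hu, hAu⟩ := hA.exists_norm_apply_sub_smul_lt hx hε
  obtain ⟨v, hv, hBv⟩ := hB.exists_norm_apply_sub_smul_lt hy hε
  have hle := norm_tensorOp_bilinear_sub_smul_le A B α β γ x y hu hv hAu.le hBv.le
  set w : HilbertTensor H K := ((u ⊗ₜ[ℂ] v : H ⊗[ℂ] K) : HilbertTensor H K)
  have hw : ‖w‖ = 1 := by
    rw [UniformSpace.Completion.norm_coe, TensorProduct.norm_tmul, hu, hv, one_mul]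
  have hRw : R (z • w - T w) = w := by
    have h : R * (algebraMap ℂ _ z - T) = 1 := by rw [← hS]; exact S.inv_val
    simpa [Algebra.algebraMap_eq_smul_one] using congrArg (fun f => f w) h
  have hlt : (1 : ℝ) < 1 :=
    calc (1 : ℝ) = ‖R (z • w - T w)‖ := by rw [hRw, hw]
      _ ≤ ‖R‖ * ‖z • w - T w‖ := R.le_opNorm _
      _ ≤ ‖R‖ * (C * (‖R‖ * C + 1)⁻¹) := by
        rw [norm_sub_rev]
        gcongr
      _ = (‖R‖ * C) / (‖R‖ * C + 1) := by ring
      _ < 1 := (div_lt_one (by positivity)).2 (lt_add_one _)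
  exact lt_irrefl _ hlt

theorem exists_mem_spectrum_of_mem_spectrum_tensorOp_bilinear {A : H →L[ℂ] H} {B : K →L[ℂ] K}
    (α β γ : ℂ) {z : ℂ}
    (hz : z ∈ spectrum ℂ (α • tensorOp A 1 + β • tensorOp 1 B + γ • tensorOp A B)) :
    ∃ x ∈ spectrum ℂ A, ∃ y ∈ spectrum ℂ B, z = α * x + β * y + γ * (x * y) := by
  rw [← tensorOp_one_right_mul_one_left A B] at hz
  obtain ⟨x, hx, y, hy, h⟩ :=
    ContinuousLinearMap.exists_mem_spectrum_of_mem_spectrum_bilinear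
      (commute_tensorOp_one_right_one_left A B) α β γ hz
  exact ⟨x, spectrum_tensorOp_one_right_subset A hx, y, spectrum_tensorOp_one_left_subset B hy, h⟩

/-- The spectrum of a bilinear polynomial in `A ⊗ 1` and `1 ⊗ B`. -/
theorem spectrum_tensorOp_bilinear [CompleteSpace H] [CompleteSpace K] {A : H →L[ℂ] H}
    {B : K →L[ℂ] K} (hA : IsSelfAdjoint A) (hB : IsSelfAdjoint B) (α β γ : ℝ) :
    spectrum ℂ ((α : ℂ) • tensorOp A 1 + (β : ℂ) • tensorOp 1 B + (γ : ℂ) • tensorOp A B) =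
      ((↑) : ℝ → ℂ) '' {z : ℝ | ∃ x y : ℝ, (x : ℂ) ∈ spectrum ℂ A ∧ (y : ℂ) ∈ spectrum ℂ B ∧
        z = α * x + β * y + γ * (x * y)} := by
  ext z
  constructor
  · intro hz
    obtain ⟨x, hx, y, hy, rfl⟩ := exists_mem_spectrum_of_mem_spectrum_tensorOp_bilinear α β γ hz
    have hxr := hA.mem_spectrum_eq_re hx
    have hyr := hB.mem_spectrum_eq_re hy
    refine ⟨α * x.re + β * y.re + γ * (x.re * y.re),
      ⟨x.re, y.re, by rwa [← hxr], by rwa [← hyr], rfl⟩, ?_⟩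
    push_cast
    rw [← hxr, ← hyr]
  · rintro ⟨_, ⟨x, y, hx, hy, rfl⟩, rfl⟩
    push_cast
    exact bilinear_mem_spectrum_tensorOp hA hB α β γ hx hy

end TensorOp

theorem proposition2 {H K : Type*}
    [NormedAddCommGroup H] [InnerProductSpace ℂ H] [CompleteSpace H]
    [NormedAddCommGroup K] [InnerProductSpace ℂ K] [CompleteSpace K]
    (A : H →L[ℂ] H) (B : K →L[ℂ] K) (hA : IsSelfAdjoint A) (hB : IsSelfAdjoint B) :
    spectrum ℂ (tensorOp A (1 : K →L[ℂ] K) + tensorOp (1 : H →L[ℂ] H) B) =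
        ((↑) : ℝ → ℂ) '' {z : ℝ | ∃ x y : ℝ,
          (x : ℂ) ∈ spectrum ℂ A ∧ (y : ℂ) ∈ spectrum ℂ B ∧ z = x + y} ∧
      spectrum ℂ (tensorOp A B) =
        ((↑) : ℝ → ℂ) '' {z : ℝ | ∃ x y : ℝ,
          (x : ℂ) ∈ spectrum ℂ A ∧ (y : ℂ) ∈ spectrum ℂ B ∧ z = x * y} ∧
      spectrum ℂ (tensorOp A (1 : K →L[ℂ] K) + tensorOp (1 : H →L[ℂ] H) B + tensorOp A B) =
        ((↑) : ℝ → ℂ) '' {z : ℝ | ∃ x y : ℝ,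
          (x : ℂ) ∈ spectrum ℂ A ∧ (y : ℂ) ∈ spectrum ℂ B ∧ z = x + y + x * y} := by
  refine ⟨?_, ?_, ?_⟩
  · simpa using spectrum_tensorOp_bilinear hA hB 1 1 0
  · simpa using spectrum_tensorOp_bilinear hA hB 0 0 1
  · simpa using spectrum_tensorOp_bilinear hA hB 1 1 1
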